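/- Fix a radio range $\rho>0$, a border width $W>\rho$ and an exponent $\theta>0$. For each $i\in\mathbb N$ let $L_i>0$ and $N_i\in\mathbb N$ be such that $L_i\to\infty$ and $M_i:=\pi\rho^2N_i/L_i^2$ satisfies $M_i=L_i^\theta$. For each $i$ let $X_{i,1},\dots,X_{i,N_i}$ be independent random points, uniformly distributed in the square $G_i=[0,L_i]^2$, and let $\mathcal V_i$ be the random unit disk graph with nodes $1,\dots,N_i$, in which two distinct nodes are neighbors when the Euclidean distance of their points is at most $\rho$. Let $s_i$ be a source node of $\mathcal V_i$, chosen in an arbitrary way (it may depend on the random points). Give the nodes of $\mathcal V_i$ the IREN/IRON transmission rates: $C_v=M_i$ if $v=s_i$ or if $v$ is a border node, i.e. its point lies in $G_i$ at distance at most $W$ from an edge of $G_i$; and $C_v=1$ for every other node. For a set $S$ of nodes with complement $T$, let $\Delta S$ be the set of nodes of $S$ that have at least one neighbor in $T$, let $C(S)=\sum_{v\in\Delta S}C_v$ be the capacity of the cut $(S,T)$, and define $$C_{\min}(s_i,t)=\min_{S\ni s_i,\ t\notin S}C(S),\qquad C_{\min}(s_i)=\min_{t\neq s_i}C_{\min}(s_i,t).$$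 Let $M_{\max,i}$ be the maximum number of neighbors of a node of $\mathcal V_i$. Then, as $i\to\infty$, $$\frac{C_{\min}(s_i)}{M_i}\to 1\quad\text{and}\quad\frac{M_{\max,i}}{M_i}\to1\qquad\text{in probability.}$$ -/

import Mathlib

open MeasureTheory ProbabilityTheory Filter

noncomputable section

namespace BroadcastNetwork

/-- The Euclidean plane. -/
abbrev Plane : Type := EuclideanSpace ℝ (Fin 2)

/-! ### Rated hypergraphs and their min-cuts

A hypergraph is given by the map `H` sending each node `v` to the set `H v` of nodes reached by
one transmission of `v`; `C v` is the rate at which `v` transmits. -/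

section Hypergraph

variable {V : Type*} [Fintype V]

open Classical in
/-- `ΔS`: the nodes of `S` that reach at least one node of the complement `T` of `S`. -/
def cutFrontier (H : V → Set V) (S : Finset V) : Finset V :=
  S.filter fun v => ∃ w ∈ H v, w ∉ S

/-- The capacity `C(S)` of the cut `(S, Sᶜ)`. -/
def cutCapacity (H : V → Set V) (C : V → ℝ) (S : Finset V) : ℝ :=
  ∑ v ∈ cutFrontier H S, C v

/-- `C_min(s,t)`: the least capacity of a cut `(S, Sᶜ)` with `s ∈ S` and `t ∈ Sᶜ`. For `s ≠ t`
the infimum is over a finite nonempty family, hence is a minimum. -/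
def minCutBetween (H : V → Set V) (C : V → ℝ) (s t : V) : ℝ :=
  ⨅ S : {S : Finset V // s ∈ S ∧ t ∉ S}, cutCapacity H C S

/-- `C_min(s)`: the least value of `C_min(s,t)` over the destinations `t ≠ s`. As soon as there
are two nodes the infimum is over a finite nonempty family, hence is a minimum. -/
def minCut (H : V → Set V) (C : V → ℝ) (s : V) : ℝ :=
  ⨅ t : {t : V // t ≠ s}, minCutBetween H C s t

end Hypergraph

/-! ### Unit disk graphs in a square -/

/-- The square area `G = [0, L] × [0, L]`. -/
def square (L : ℝ) : Set Plane := {p | ∀ k, p k ∈ Set.Icc 0 L}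

/-- The border area `ΔG`: the points of `G` at distance at most `W` from an edge of `G`. -/
def border (L W : ℝ) : Set Plane := {p ∈ square L | ∃ k, p k ≤ W ∨ L - W ≤ p k}

/-- The unit disk graph of radio range `ρ` on nodes placed at the points `x v`: two different nodes
are neighbors when their distance is at most `ρ`. -/
def unitDiskGraph {V : Type*} (ρ : ℝ) (x : V → Plane) : SimpleGraph V where
  Adj u v := u ≠ v ∧ dist (x u) (x v) ≤ ρ
  symm := ⟨fun u v h => ⟨h.1.symm, by rw [dist_comm]; exact h.2⟩⟩
  loopless := ⟨fun _ h => h.1 rfl⟩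

/-- `M = π ρ² N / L²`, the expected number of neighbors of a node. -/
def expectedNeighbors (ρ L : ℝ) (N : ℕ) : ℝ := Real.pi * ρ ^ 2 * (N / L ^ 2)

open Classical in
/-- `M_max`: the maximum number of neighbors of a node. -/
def maxNeighbors {N : ℕ} (ρ : ℝ) (x : Fin N → Plane) : ℕ := (unitDiskGraph ρ x).maxDegree

open Classical in
/-- The IREN/IRON rates: the source `s` and the border nodes transmit at rate `M`, every other node
at rate `1`. -/
def irenIronRate {N : ℕ} (ρ W L : ℝ) (x : Fin N → Plane) (s v : Fin N) : ℝ :=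
  if v = s ∨ x v ∈ border L W then expectedNeighbors ρ L N else 1

/-- `C_min(s)` for the unit disk hypergraph (each transmission of a node reaches all its neighbors)
with the IREN/IRON rates. -/
def irenIronMinCut {N : ℕ} (ρ W L : ℝ) (x : Fin N → Plane) (s : Fin N) : ℝ :=
  minCut (unitDiskGraph ρ x).neighborSet (irenIronRate ρ W L x s) s

end BroadcastNetwork

end

/-!
The capacity of `{s}` is at most `M`, so `C_min(s) ≤ M`. For the converse, let `(S, T)` be a cut with
`s ∈ S`. If the frontier `ΔS` contains `s` or a border node, its capacity is at least `M`. Otherwise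
the nodes near the edges of the square all lie in `S` or all lie in `T`, because the border is
connected and the nodes are dense in it (`IsTypical.exists_border_mem_cutFrontier`). Hence either
`T` or `S \ ΔS` is a nonempty set `E` of inner nodes all of whose neighbors outside `E` belong to
`ΔS`. Take a rightmost node `r` and a leftmost node `l` of `E`. The nodes in the right half of the
disk of radius `ρ` around `r` and those in the left half of the disk around `l` are distinct, lie
outside `E`, and are neighbors of `r` and `l`. So `ΔS` has at least as many nodes as two half-disks,
that is, about `M` (`IsTypical.le_card_of_neighbors_subset`). This is an elementary discrete form of
the Brunn–Minkowski inequality, and it involves only regions centered at nodes.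

It remains to see that, with high probability, all half-disks around inner nodes and all disks
around nodes have about the expected number of nodes, and the nodes are dense
(`uniformNodes_not_isTypical_le`). Conditionally on one node, the number of the other nodes in a
disk around it is binomial, and its exponential moments give deviation probabilities of order
`exp (-c * M)`. Density follows by subdividing the square into cells of constant size, each of which
is empty with probability at most `exp (-c * M)`. As `M = L ^ θ`, these probabilities beat the
union bound over the polynomially many nodes and cells (`tendsto_union_bound`). The estimates hold
for all possible sources at once, so the choice of the source is immaterial.
-/

open MeasureTheory ProbabilityTheory Filter

namespace BroadcastNetwork

/-! ### Typical configurations of nodes -/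

/-- The points of the closed disk of radius `ρ` around `p` strictly to the right of `p`. -/
def rightHalfDisk (ρ : ℝ) (p : Plane) : Set Plane := {q | dist p q ≤ ρ ∧ p 0 < q 0}

/-- The points of the closed disk of radius `ρ` around `p` strictly to the left of `p`. -/
def leftHalfDisk (ρ : ℝ) (p : Plane) : Set Plane := {q | dist p q ≤ ρ ∧ q 0 < p 0}

open Classical in
/-- A configuration of nodes in the square of side `L` is typical, with tolerances `ε` and `δ`, when
all half-disks and disks around nodes contain about as many nodes as expected (only from above
for the disks, which may stick out of the square, and only from below for the half-disks around
nodes farther than `ρ` from the edges), and when the nodes are `δ`-dense in the square. The number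
`M` stands for the expected number of nodes in a disk. -/
structure IsTypical (ρ L M ε δ : ℝ) {N : ℕ} (x : Fin N → Plane) : Prop where
  mem_square : ∀ j, x j ∈ square L
  right : ∀ j, x j ∉ border L ρ →
    (1 - ε) * (M / 2) ≤ (Finset.univ.filter fun k => x k ∈ rightHalfDisk ρ (x j)).card
  left : ∀ j, x j ∉ border L ρ →
    (1 - ε) * (M / 2) ≤ (Finset.univ.filter fun k => x k ∈ leftHalfDisk ρ (x j)).card
  disk : ∀ j, ((Finset.univ.filter fun k => k ≠ j ∧ dist (x j) (x k) ≤ ρ).card : ℝ) ≤ (1 + ε) * M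
  dense : ∀ p ∈ square L, ∃ j, dist (x j) p ≤ δ

variable {ρ L M ε δ W : ℝ} {N : ℕ} {x : Fin N → Plane}

/-! ### The number of neighbors outside a set of inner nodes -/

/-- The discrete isoperimetric inequality: the right half-disk around a rightmost node of `E` and
the left half-disk around a leftmost node of `E` are disjoint and avoid `E`, and together they
have the area of a disk. -/
lemma IsTypical.le_card_of_neighbors_subset (hx : IsTypical ρ L M ε δ x) {E F : Finset (Fin N)}
    (hE : E.Nonempty) (hborder : ∀ v ∈ E, x v ∉ border L ρ)
    (hF : ∀ v ∈ E, ∀ k, (unitDiskGraph ρ x).Adj v k → k ∉ E → k ∈ F) :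
    (1 - ε) * M ≤ F.card := by
  classical
  obtain ⟨r, hr, hrmax⟩ := E.exists_max_image (fun v => x v 0) hE
  obtain ⟨l, hl, hlmin⟩ := E.exists_min_image (fun v => x v 0) hE
  set R := Finset.univ.filter fun k => x k ∈ rightHalfDisk ρ (x r)
  set Q := Finset.univ.filter fun k => x k ∈ leftHalfDisk ρ (x l)
  have hdisj : Disjoint R Q := by
    rw [Finset.disjoint_left]
    intro k hkR hkQ
    have h1 := (Finset.mem_filter.1 hkR).2.2
    have h2 := (Finset.mem_filter.1 hkQ).2.2
    have h3 := hrmax l hl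
    linarith
  have hsub : R ∪ Q ⊆ F := by
    intro k hk
    rcases Finset.mem_union.1 hk with hk | hk
    · obtain ⟨h1, h2⟩ := (Finset.mem_filter.1 hk).2
      refine hF r hr k ⟨?_, h1⟩ fun hkE => (hrmax k hkE).not_gt h2
      rintro rfl
      exact lt_irrefl _ h2
    · obtain ⟨h1, h2⟩ := (Finset.mem_filter.1 hk).2
      refine hF l hl k ⟨?_, h1⟩ fun hkE => (hlmin k hkE).not_gt h2
      rintro rfl
      exact lt_irrefl _ h2
  have hcard : (R.card : ℝ) + Q.card ≤ F.card := by
    rw [← Nat.cast_add, ← Finset.card_union_of_disjoint hdisj]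
    exact_mod_cast Finset.card_le_card hsub
  have h1 := hx.right r (hborder r hr)
  have h2 := hx.left l (hborder l hl)
  linarith

/-! ### The frontier of a cut -/

lemma mem_cutFrontier {V : Type*} [Fintype V] {H : V → Set V} {S : Finset V} {v : V} :
    v ∈ cutFrontier H S ↔ v ∈ S ∧ ∃ w ∈ H v, w ∉ S := by
  simp [cutFrontier]

lemma cutFrontier_subset {V : Type*} [Fintype V] {H : V → Set V} {S : Finset V} :
    cutFrontier H S ⊆ S :=
  fun _ hv => (mem_cutFrontier.1 hv).1

/-! ### Connectedness of the border -/

lemma convex_square_inter_le (L c : ℝ) (k : Fin 2) : Convex ℝ {p ∈ square L | p k ≤ c} := by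
  rintro p ⟨hp, hpk⟩ q ⟨hq, hqk⟩ a b ha hb hab
  refine ⟨fun j => (convex_Icc 0 L) (hp j) (hq j) ha hb hab, ?_⟩
  exact (convex_Iic c) (Set.mem_Iic.2 hpk) (Set.mem_Iic.2 hqk) ha hb hab

lemma convex_square_inter_ge (L c : ℝ) (k : Fin 2) : Convex ℝ {p ∈ square L | c ≤ p k} := by
  rintro p ⟨hp, hpk⟩ q ⟨hq, hqk⟩ a b ha hb hab
  refine ⟨fun j => (convex_Icc 0 L) (hp j) (hq j) ha hb hab, ?_⟩
  exact (convex_Ici c) (Set.mem_Ici.2 hpk) (Set.mem_Ici.2 hqk) ha hb hab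

/-- The border is a union of four rectangles, consecutive ones of which share a corner. -/
lemma isPreconnected_border (hL : 0 ≤ L) (hρ : 0 ≤ ρ) : IsPreconnected (border L ρ) := by
  have key : border L ρ = ({p ∈ square L | p 0 ≤ ρ} ∪ {p ∈ square L | p 1 ≤ ρ}) ∪
      ({p ∈ square L | L - ρ ≤ p 0} ∪ {p ∈ square L | L - ρ ≤ p 1}) := by
    ext p
    simp only [border, Fin.exists_fin_two, Set.mem_union, Set.mem_ofPred_eq]
    tauto
  have h00 : (!₂[0, 0] : Plane) ∈ square L := by intro k; fin_cases k <;> simp [hL]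
  have hLL : (!₂[L, L] : Plane) ∈ square L := by intro k; fin_cases k <;> simp [hL]
  have hL0 : (!₂[L, 0] : Plane) ∈ square L := by intro k; fin_cases k <;> simp [hL]
  rw [key]
  refine IsPreconnected.union (!₂[L, 0] : Plane) (Or.inr ⟨hL0, by simpa using hρ⟩)
    (Or.inl ⟨hL0, by simpa using hρ⟩) ?_ ?_
  · exact IsPreconnected.union (!₂[0, 0] : Plane) ⟨h00, by simpa using hρ⟩
      ⟨h00, by simpa using hρ⟩ (convex_square_inter_le L ρ 0).isPreconnected
      (convex_square_inter_le L ρ 1).isPreconnected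
  · exact IsPreconnected.union (!₂[L, L] : Plane) ⟨hLL, by simpa using hρ⟩
      ⟨hLL, by simpa using hρ⟩ (convex_square_inter_ge L (L - ρ) 0).isPreconnected
      (convex_square_inter_ge L (L - ρ) 1).isPreconnected

lemma abs_coord_sub_le_dist (p q : Plane) (k : Fin 2) : |p k - q k| ≤ dist p q := by
  rw [dist_eq_norm]
  simpa using PiLp.norm_apply_le (p - q) k

/-- If the nodes are dense enough, then a set `S` of nodes that separates two nodes at distance at
most `ρ` from the edges has a frontier node in the wider border of width `W`: in the connected
border of width `ρ`, the points close to `S` and the points close to its complement overlap. -/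
lemma IsTypical.exists_border_mem_cutFrontier (hx : IsTypical ρ L M ε δ x) (hρ : 0 < ρ)
    (hL : 0 ≤ L) (hδ : 0 ≤ δ) (hδρ : 2 * δ ≤ ρ) (hδW : ρ + δ ≤ W) {S : Finset (Fin N)} {a b : Fin N}
    (ha : x a ∈ border L ρ) (haS : a ∈ S) (hb : x b ∈ border L ρ) (hbS : b ∉ S) :
    ∃ v ∈ cutFrontier (unitDiskGraph ρ x).neighborSet S, x v ∈ border L W := by
  classical
  have hclosed : ∀ A : Finset (Fin N), IsClosed (⋃ v ∈ A, Metric.closedBall (x v) δ) := fun A =>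
    A.finite_toSet.isClosed_biUnion fun v _ => Metric.isClosed_closedBall
  obtain ⟨p, hp, hpS, hpT⟩ := isPreconnected_closed_iff.1 (isPreconnected_border hL hρ.le)
    (⋃ v ∈ S, Metric.closedBall (x v) δ) (⋃ v ∈ Sᶜ, Metric.closedBall (x v) δ)
    (hclosed S) (hclosed Sᶜ)
    (fun p hp => by
      obtain ⟨j, hj⟩ := hx.dense p hp.1
      by_cases hjS : j ∈ S
      · exact Or.inl (Set.mem_iUnion₂.2 ⟨j, hjS, by rwa [Metric.mem_closedBall, dist_comm]⟩)
      · exact Or.inr (Set.mem_iUnion₂.2 ⟨j, Finset.mem_compl.2 hjS,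
          by rwa [Metric.mem_closedBall, dist_comm]⟩))
    ⟨x a, ha, Set.mem_iUnion₂.2 ⟨a, haS, Metric.mem_closedBall_self hδ⟩⟩
    ⟨x b, hb, Set.mem_iUnion₂.2 ⟨b, Finset.mem_compl.2 hbS, Metric.mem_closedBall_self hδ⟩⟩
  obtain ⟨u, huS, hu⟩ := Set.mem_iUnion₂.1 hpS
  obtain ⟨w, hwT, hw⟩ := Set.mem_iUnion₂.1 hpT
  rw [Finset.mem_compl] at hwT
  rw [Metric.mem_closedBall] at hu hw
  refine ⟨u, ?_, hx.mem_square u, ?_⟩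
  · refine mem_cutFrontier.2 ⟨huS, w, ⟨fun h => hwT (h ▸ huS), ?_⟩, hwT⟩
    linarith [dist_triangle_left (x u) (x w) p]
  · obtain ⟨-, k, hk⟩ := hp
    have h := abs_le.1 ((abs_coord_sub_le_dist p (x u) k).trans hu)
    refine ⟨k, hk.imp (fun hk => ?_) fun hk => ?_⟩ <;> linarith [h.1, h.2]

/-! ### Cuts of typical configurations -/

/-- Either the frontier contains the source or a border node, whose rate alone is `M`, or the inner
frontier nodes are at least `(1 - ε) * M` in number, by `IsTypical.le_card_of_neighbors_subset`
applied to `S` without its frontier or to the complement of `S`, whichever misses the border. -/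
lemma IsTypical.le_cutCapacity (hx : IsTypical ρ L (expectedNeighbors ρ L N) ε δ x) (hρ : 0 < ρ)
    (hL : 0 ≤ L) (hδ : 0 ≤ δ) (hδρ : 2 * δ ≤ ρ) (hδW : ρ + δ ≤ W) (hε : 0 ≤ ε)
    (hM : 1 ≤ expectedNeighbors ρ L N) {s t : Fin N} {S : Finset (Fin N)}
    (hs : s ∈ S) (ht : t ∉ S) :
    (1 - ε) * expectedNeighbors ρ L N ≤
      cutCapacity (unitDiskGraph ρ x).neighborSet (irenIronRate ρ W L x s) S := by
  classical
  set M := expectedNeighbors ρ L N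
  set H := (unitDiskGraph ρ x).neighborSet
  have hrate : ∀ v, 1 ≤ irenIronRate ρ W L x s v := by
    intro v
    unfold irenIronRate
    split_ifs
    exacts [hM, le_rfl]
  by_cases hv : ∃ v ∈ cutFrontier H S, v = s ∨ x v ∈ border L W
  · obtain ⟨v, hvF, hv⟩ := hv
    have h1 : irenIronRate ρ W L x s v = M := if_pos hv
    have h2 : irenIronRate ρ W L x s v ≤ cutCapacity H (irenIronRate ρ W L x s) S :=
      Finset.single_le_sum (f := irenIronRate ρ W L x s)
        (fun u _ => zero_le_one.trans (hrate u)) hvF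
    nlinarith
  · push Not at hv
    have hcard : ((cutFrontier H S).card : ℝ) ≤ cutCapacity H (irenIronRate ρ W L x s) S := by
      have h := Finset.card_nsmul_le_sum (cutFrontier H S) (irenIronRate ρ W L x s) 1
        fun v _ => hrate v
      rwa [nsmul_eq_mul, mul_one] at h
    refine le_trans ?_ hcard
    have hmem : ∀ v ∈ S, ∀ k ∉ S, (unitDiskGraph ρ x).Adj v k → v ∈ cutFrontier H S :=
      fun v hv k hk hvk => mem_cutFrontier.2 ⟨hv, k, hvk, hk⟩
    by_cases hB : ∃ a ∈ S, x a ∈ border L ρ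
    · obtain ⟨a, haS, ha⟩ := hB
      refine hx.le_card_of_neighbors_subset (E := Sᶜ) ⟨t, Finset.mem_compl.2 ht⟩ ?_ ?_
      · intro b hb hbB
        obtain ⟨v, hvF, hvB⟩ := hx.exists_border_mem_cutFrontier hρ hL hδ hδρ hδW ha haS hbB
          (Finset.mem_compl.1 hb)
        exact (hv v hvF).2 hvB
      · intro v hv k hvk hk
        rw [Finset.mem_compl, not_not] at hk
        exact hmem k hk v (Finset.mem_compl.1 hv) hvk.symm
    · push Not at hB
      refine hx.le_card_of_neighbors_subset (E := S \ cutFrontier H S)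
        ⟨s, Finset.mem_sdiff.2 ⟨hs, fun h => (hv s h).1 rfl⟩⟩
        (fun v hv => hB v (Finset.mem_sdiff.1 hv).1) ?_
      intro v hv k hvk hk
      rw [Finset.mem_sdiff] at hv hk
      by_contra hkF
      exact hk ⟨by_contra fun hkS => hv.2 (hmem v hv.1 k hkS hvk), hkF⟩

lemma irenIronMinCut_le (hN : 2 ≤ N) (hM : 1 ≤ expectedNeighbors ρ L N) (s : Fin N) :
    irenIronMinCut ρ W L x s ≤ expectedNeighbors ρ L N := by
  classical
  set H := (unitDiskGraph ρ x).neighborSet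
  have hrate : ∀ v, 0 ≤ irenIronRate ρ W L x s v := by
    intro v
    unfold irenIronRate
    split_ifs <;> linarith
  have hcap : ∀ S, 0 ≤ cutCapacity H (irenIronRate ρ W L x s) S := fun S =>
    Finset.sum_nonneg fun v _ => hrate v
  have : Nontrivial (Fin N) := Fin.nontrivial_iff_two_le.2 hN
  obtain ⟨t, ht⟩ := exists_ne s
  refine (ciInf_le ⟨0, ?_⟩ (⟨t, ht⟩ : {t : Fin N // t ≠ s})).trans ?_
  · rintro _ ⟨t, rfl⟩
    exact Real.iInf_nonneg fun S => hcap _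
  refine (ciInf_le ⟨0, ?_⟩ (⟨{s}, by simp, by simpa using ht⟩ :
    {S : Finset (Fin N) // s ∈ S ∧ t ∉ S})).trans ?_
  · rintro _ ⟨S, rfl⟩
    exact hcap _
  calc cutCapacity H (irenIronRate ρ W L x s) {s}
      ≤ ∑ v ∈ {s}, irenIronRate ρ W L x s v :=
        Finset.sum_le_sum_of_subset_of_nonneg cutFrontier_subset fun v _ _ => hrate v
    _ = expectedNeighbors ρ L N := by simp [irenIronRate]

lemma IsTypical.le_irenIronMinCut (hx : IsTypical ρ L (expectedNeighbors ρ L N) ε δ x) (hρ : 0 < ρ)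
    (hL : 0 ≤ L) (hδ : 0 ≤ δ) (hδρ : 2 * δ ≤ ρ) (hδW : ρ + δ ≤ W) (hε : 0 ≤ ε)
    (hN : 2 ≤ N) (hM : 1 ≤ expectedNeighbors ρ L N) (s : Fin N) :
    (1 - ε) * expectedNeighbors ρ L N ≤ irenIronMinCut ρ W L x s := by
  have : Nontrivial (Fin N) := Fin.nontrivial_iff_two_le.2 hN
  obtain ⟨t₀, ht₀⟩ := exists_ne s
  have : Nonempty {t : Fin N // t ≠ s} := ⟨⟨t₀, ht₀⟩⟩
  refine le_ciInf fun t => ?_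
  have : Nonempty {S : Finset (Fin N) // s ∈ S ∧ (t : Fin N) ∉ S} :=
    ⟨⟨{s}, by simp, by simpa using t.2⟩⟩
  exact le_ciInf fun S => hx.le_cutCapacity hρ hL hδ hδρ hδW hε hM S.2.1 S.2.2

/-! ### The maximum degree of a typical configuration -/

lemma degree_unitDiskGraph (j : Fin N) [Fintype ((unitDiskGraph ρ x).neighborSet j)]
    [DecidablePred fun k => k ≠ j ∧ dist (x j) (x k) ≤ ρ] :
    (unitDiskGraph ρ x).degree j =
      (Finset.univ.filter fun k => k ≠ j ∧ dist (x j) (x k) ≤ ρ).card := by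
  rw [← SimpleGraph.card_neighborFinset_eq_degree]
  congr 1
  ext k
  rw [SimpleGraph.mem_neighborFinset]
  simp [unitDiskGraph, ne_comm]

lemma IsTypical.maxNeighbors_le (hx : IsTypical ρ L M ε δ x) (hM : 0 ≤ (1 + ε) * M) :
    (maxNeighbors ρ x : ℝ) ≤ (1 + ε) * M := by
  classical
  unfold maxNeighbors
  rcases isEmpty_or_nonempty (Fin N) with h | h
  · simpa [SimpleGraph.maxDegree] using hM
  · obtain ⟨j, hj⟩ := (unitDiskGraph ρ x).exists_maximal_degree_vertex
    have h := hx.disk j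
    rw [← degree_unitDiskGraph, ← hj] at h
    exact h

/-- A node near the center of the square already has about `M` neighbors: the single node forms a
set to which the isoperimetric inequality applies. -/
lemma IsTypical.le_maxNeighbors (hx : IsTypical ρ L M ε δ x) (hL : 0 ≤ L)
    (hδL : 2 * (ρ + δ) < L) : (1 - ε) * M ≤ maxNeighbors ρ x := by
  classical
  obtain ⟨j, hj⟩ := hx.dense (!₂[L / 2, L / 2] : Plane) (by
    intro k; fin_cases k <;> simp <;> constructor <;> linarith)
  have hjB : x j ∉ border L ρ := by
    rintro ⟨-, k, hk⟩
    have h := abs_le.1 ((abs_coord_sub_le_dist (x j) !₂[L / 2, L / 2] k).trans hj)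
    have h2 : (!₂[L / 2, L / 2] : Plane) k = L / 2 := by fin_cases k <;> simp
    rw [h2] at h
    rcases hk with hk | hk <;> linarith [h.1, h.2]
  have h := hx.le_card_of_neighbors_subset (E := {j})
    (F := (unitDiskGraph ρ x).neighborFinset j) (by simp) (by simpa using hjB)
    (by intro v hv k hvk _; rw [Finset.mem_singleton.1 hv] at hvk; simpa using hvk)
  refine h.trans ?_
  unfold maxNeighbors
  have h3 := (unitDiskGraph ρ x).degree_le_maxDegree j
  rw [← SimpleGraph.card_neighborFinset_eq_degree] at h3
  exact Nat.cast_le.2 h3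

/-! ### Areas -/

lemma volume_box (a b : Fin 2 → ℝ) :
    volume {p : Plane | ∀ k, p k ∈ Set.Icc (a k) (b k)} =
      ENNReal.ofReal (b 0 - a 0) * ENNReal.ofReal (b 1 - a 1) := by
  have h : {p : Plane | ∀ k, p k ∈ Set.Icc (a k) (b k)} = WithLp.ofLp ⁻¹' Set.Icc a b := by
    ext p
    simp [Pi.le_def, forall_and]
  rw [h, (PiLp.volume_preserving_ofLp (Fin 2)).measure_preimage measurableSet_Icc.nullMeasurableSet,
    Real.volume_Icc_pi, Fin.prod_univ_two]

lemma measurable_coord (k : Fin 2) : Measurable fun p : Plane => p k :=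
  (continuous_apply k |>.comp (PiLp.continuous_ofLp 2 _)).measurable

lemma measurableSet_box (a b : Fin 2 → ℝ) :
    MeasurableSet {p : Plane | ∀ k, p k ∈ Set.Icc (a k) (b k)} := by
  rw [Set.ofPred_forall]
  exact MeasurableSet.iInter fun k => measurable_coord k measurableSet_Icc

lemma volume_square (L : ℝ) : volume (square L) = ENNReal.ofReal L ^ 2 := by
  have := volume_box (fun _ => 0) (fun _ => L)
  simpa [square, sq] using this

lemma measurableSet_square (L : ℝ) : MeasurableSet (square L) :=
  measurableSet_box (fun _ => 0) (fun _ => L)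

lemma measurableSet_border (L W : ℝ) : MeasurableSet (border L W) := by
  have h : border L W = square L ∩ ⋃ k, ({p : Plane | p k ≤ W} ∪ {p : Plane | L - W ≤ p k}) := by
    ext p
    simp [border]
    tauto
  rw [h]
  exact (measurableSet_square L).inter (MeasurableSet.iUnion fun k =>
    (measurableSet_le (measurable_coord k) measurable_const).union
      (measurableSet_le measurable_const (measurable_coord k)))

lemma volume_vertical_line (c : ℝ) : volume {q : Plane | q 0 = c} = 0 := by
  have h : {q : Plane | q 0 = c} = WithLp.ofLp ⁻¹' {f : Fin 2 → ℝ | f 0 = c} := rfl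
  rw [h, (PiLp.volume_preserving_ofLp (Fin 2)).measure_preimage
    (measurableSet_eq_fun (measurable_pi_apply 0) measurable_const).nullMeasurableSet]
  exact Measure.pi_hyperplane (fun _ : Fin 2 => (volume : Measure ℝ)) 0 c

lemma measurableSet_rightHalfDisk_prod (ρ : ℝ) :
    MeasurableSet {z : Plane × Plane | z.2 ∈ rightHalfDisk ρ z.1} :=
  (measurableSet_le measurable_dist measurable_const).inter
    (measurableSet_lt ((measurable_coord 0).comp measurable_fst)
      ((measurable_coord 0).comp measurable_snd))

lemma measurableSet_leftHalfDisk_prod (ρ : ℝ) :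
    MeasurableSet {z : Plane × Plane | z.2 ∈ leftHalfDisk ρ z.1} :=
  (measurableSet_le measurable_dist measurable_const).inter
    (measurableSet_lt ((measurable_coord 0).comp measurable_snd)
      ((measurable_coord 0).comp measurable_fst))

lemma measurableSet_disk_prod (ρ : ℝ) :
    MeasurableSet {z : Plane × Plane | dist z.1 z.2 ≤ ρ} :=
  measurableSet_le measurable_dist measurable_const

lemma measurableSet_rightHalfDisk (ρ : ℝ) (p : Plane) : MeasurableSet (rightHalfDisk ρ p) :=
  measurable_prodMk_left (x := p) (measurableSet_rightHalfDisk_prod ρ)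

lemma measurableSet_leftHalfDisk (ρ : ℝ) (p : Plane) : MeasurableSet (leftHalfDisk ρ p) :=
  measurable_prodMk_left (x := p) (measurableSet_leftHalfDisk_prod ρ)

/-- The point reflection in `p` exchanges the two half-disks around `p`. -/
lemma volume_leftHalfDisk_eq (ρ : ℝ) (p : Plane) :
    volume (leftHalfDisk ρ p) = volume (rightHalfDisk ρ p) := by
  have h := (Measure.measurePreserving_sub_left (volume : Measure Plane)
    (p + p)).measure_preimage (measurableSet_rightHalfDisk ρ p).nullMeasurableSet
  rw [← h]
  congr 1
  ext q
  have h1 : dist p (p + p - q) = dist p q := by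
    rw [dist_eq_norm, dist_eq_norm, show p - (p + p - q) = -(p - q) by abel, norm_neg]
  simp only [leftHalfDisk, rightHalfDisk, Set.mem_preimage, Set.mem_ofPred_eq, h1,
    PiLp.sub_apply, PiLp.add_apply]
  constructor <;> rintro ⟨h2, h3⟩ <;> exact ⟨h2, by linarith⟩

lemma volume_disk {ρ : ℝ} (hρ : 0 ≤ ρ) (p : Plane) :
    volume {q : Plane | dist p q ≤ ρ} = ENNReal.ofReal (Real.pi * ρ ^ 2) := by
  have h : {q : Plane | dist p q ≤ ρ} = Metric.closedBall p ρ := by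
    ext q; simp [dist_comm]
  rw [h, EuclideanSpace.volume_closedBall_fin_two, ← ENNReal.ofReal_pow hρ,
    ← ENNReal.ofReal_mul (by positivity), mul_comm]

lemma volume_rightHalfDisk {ρ : ℝ} (hρ : 0 ≤ ρ) (p : Plane) :
    volume (rightHalfDisk ρ p) = ENNReal.ofReal (Real.pi * ρ ^ 2 / 2) := by
  have h : volume (rightHalfDisk ρ p ∪ leftHalfDisk ρ p) = volume {q : Plane | dist p q ≤ ρ} := by
    refine le_antisymm (measure_mono ?_) ?_
    · rintro q (hq | hq) <;> exact hq.1
    · refine (measure_mono (t := (rightHalfDisk ρ p ∪ leftHalfDisk ρ p) ∪ {q : Plane | q 0 = p 0})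
        fun q hq => ?_).trans
        ((measure_union_le _ _).trans (by rw [volume_vertical_line, add_zero]))
      rcases lt_trichotomy (p 0) (q 0) with h | h | h
      exacts [Or.inl (Or.inl ⟨hq, h⟩), Or.inr h.symm, Or.inl (Or.inr ⟨hq, h⟩)]
  have hdisj : Disjoint (rightHalfDisk ρ p) (leftHalfDisk ρ p) :=
    Set.disjoint_left.2 fun q h1 h2 => h1.2.not_gt h2.2
  rw [measure_union hdisj (measurableSet_leftHalfDisk ρ p), volume_leftHalfDisk_eq,
    volume_disk hρ, ← two_mul] at h
  rw [ENNReal.ofReal_div_of_pos two_pos, ← h, ENNReal.ofReal_ofNat,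
    mul_comm, ENNReal.mul_div_cancel_right (by simp) (by simp)]

/-! ### The uniform distribution on the square -/

/-- The uniform distribution on the square of side `L`. -/
noncomputable abbrev uniformSquare (L : ℝ) : Measure Plane := cond volume (square L)

variable {ρ L : ℝ}

lemma isProbabilityMeasure_uniformSquare (hL : 0 < L) : IsProbabilityMeasure (uniformSquare L) :=
  cond_isProbabilityMeasure_of_finite (by rw [volume_square]; simpa using hL)
    (by rw [volume_square]; finiteness)

lemma uniformSquare_real_le (hL : 0 < L) {D : Set Plane} {c : ℝ} (hc : 0 ≤ c)
    (hD : volume D ≤ ENNReal.ofReal c) : (uniformSquare L).real D ≤ c / L ^ 2 := by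
  rw [measureReal_def, cond_apply (measurableSet_square L), volume_square, ENNReal.toReal_mul,
    ENNReal.toReal_inv, ENNReal.toReal_pow, ENNReal.toReal_ofReal hL.le, div_eq_inv_mul]
  gcongr
  exact ENNReal.toReal_le_of_le_ofReal hc ((measure_mono Set.inter_subset_right).trans hD)

lemma uniformSquare_real_eq (hL : 0 < L) {D : Set Plane} {c : ℝ} (hc : 0 ≤ c)
    (hDL : D ⊆ square L) (hD : volume D = ENNReal.ofReal c) :
    (uniformSquare L).real D = c / L ^ 2 := by
  rw [measureReal_def, cond_apply (measurableSet_square L), volume_square, ENNReal.toReal_mul,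
    ENNReal.toReal_inv, ENNReal.toReal_pow, ENNReal.toReal_ofReal hL.le, div_eq_inv_mul,
    Set.inter_eq_self_of_subset_right hDL, hD, ENNReal.toReal_ofReal hc]

lemma uniformSquare_compl_square (L : ℝ) : uniformSquare L (square L)ᶜ = 0 := by
  rw [cond_apply (measurableSet_square L), Set.inter_compl_self, measure_empty, mul_zero]

lemma disk_subset_square {p : Plane} (hp : p ∈ square L) (hpB : p ∉ border L ρ) :
    {q : Plane | dist p q ≤ ρ} ⊆ square L := by
  intro q hq k
  have h := abs_le.1 ((abs_coord_sub_le_dist p q k).trans hq)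
  have h2 : ρ < p k ∧ p k < L - ρ := by
    by_contra h3
    exact hpB ⟨hp, k, by grind⟩
  constructor <;> linarith

/-! ### Exponential moments of the number of points in a set -/

open Classical in
lemma card_filter_ne_eq_sum {E : Type*} {n : ℕ} (R : E → Set E) (j : Fin (n + 1))
    (x : Fin (n + 1) → E) :
    ((Finset.univ.filter fun k => k ≠ j ∧ x k ∈ R (x j)).card : ℝ) =
      ∑ k, (R (x j)).indicator 1 (x (j.succAbove k)) := by
  rw [Finset.card_filter, Nat.cast_sum, Fin.sum_univ_succAbove _ j]
  simp [Set.indicator_apply, Fin.succAbove_ne]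

section Chernoff

variable {E : Type*} [MeasurableSpace E] {μ : Measure E} [IsProbabilityMeasure μ]

lemma integral_exp_indicator {D : Set E} (hD : MeasurableSet D) (t : ℝ) :
    ∫ y, Real.exp (t * D.indicator 1 y) ∂μ = 1 + μ.real D * (Real.exp t - 1) := by
  have h : ∀ y, Real.exp (t * D.indicator 1 y) = 1 + D.indicator (fun _ => Real.exp t - 1) y := by
    intro y
    by_cases hy : y ∈ D <;> simp [hy]
  simp_rw [h]
  rw [integral_add (integrable_const _) ((integrable_const _).indicator hD),
    integral_indicator_const _ hD]
  simp

/-- The exponential Markov inequality for the number of points in `D` among `n` independent random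
points with distribution `μ`. It bounds the upper tail when `t > 0` and the lower tail when
`t < 0`. -/
lemma pi_count_le_exp {D : Set E} (hD : MeasurableSet D) (n : ℕ) (t a : ℝ) :
    (Measure.pi fun _ : Fin n => μ).real {y | t * a ≤ t * ∑ k, D.indicator 1 (y k)} ≤
      Real.exp (-(t * a) + n * (μ.real D * (Real.exp t - 1))) := by
  have hmeas : Measurable fun y : Fin n → E => t * ∑ k, D.indicator (1 : E → ℝ) (y k) :=
    (Finset.measurable_sum _ fun k _ =>
      (measurable_one.indicator hD).comp (measurable_pi_apply k)).const_mul t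
  have hbound : ∀ y : Fin n → E, t * ∑ k, D.indicator (1 : E → ℝ) (y k) ≤ |t| * n := by
    intro y
    have h0 : ∀ k, 0 ≤ D.indicator (1 : E → ℝ) (y k) := fun k =>
      Set.indicator_nonneg (fun _ _ => zero_le_one) _
    have h1 : ∑ k, D.indicator (1 : E → ℝ) (y k) ≤ n := by
      refine (Finset.sum_le_card_nsmul _ _ 1 fun k _ => ?_).trans (by simp)
      exact Set.indicator_le_self' (fun _ _ => zero_le_one) _
    exact mul_le_mul (le_abs_self t) h1 (Finset.sum_nonneg fun k _ => h0 k) (abs_nonneg t)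
  have hint : Integrable (fun y : Fin n → E =>
      Real.exp (1 * (t * ∑ k, D.indicator (1 : E → ℝ) (y k)))) (Measure.pi fun _ => μ) := by
    simp_rw [one_mul]
    refine Integrable.of_bound (Real.measurable_exp.comp hmeas).aestronglyMeasurable
      (Real.exp (|t| * n)) (Eventually.of_forall fun y => ?_)
    rw [Real.norm_eq_abs, Real.abs_exp, Real.exp_le_exp]
    exact hbound y
  refine (measure_ge_le_exp_mul_mgf (t * a) zero_le_one hint).trans ?_
  have hmgf : mgf (fun y : Fin n → E => t * ∑ k, D.indicator (1 : E → ℝ) (y k))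
      (Measure.pi fun _ => μ) 1 = (1 + μ.real D * (Real.exp t - 1)) ^ n := by
    unfold mgf
    simp_rw [one_mul, Finset.mul_sum, Real.exp_sum]
    rw [integral_fintype_prod_eq_prod (fun _ y => Real.exp (t * D.indicator 1 y))]
    simp [integral_exp_indicator hD]
  have hnonneg : 0 ≤ 1 + μ.real D * (Real.exp t - 1) := by
    rw [← integral_exp_indicator hD]
    exact integral_nonneg fun y => (Real.exp_pos _).le
  rw [hmgf, neg_one_mul, Real.exp_add]
  refine mul_le_mul_of_nonneg_left ?_ (Real.exp_pos _).le
  rw [Real.exp_nat_mul]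
  refine pow_le_pow_left₀ hnonneg ?_ n
  rw [add_comm]
  exact Real.add_one_le_exp _

lemma exp_sub_one_le {t : ℝ} (ht : |t| ≤ 1) : Real.exp t - 1 ≤ t + t ^ 2 := by
  have h := (abs_le.1 (Real.abs_exp_sub_one_sub_id_le ht)).2
  linarith

lemma pi_count_upper_tail {D : Set E} (hD : MeasurableSet D) {n : ℕ} {η m : ℝ} (hη : 0 ≤ η)
    (hη1 : η ≤ 1) (hm : n * μ.real D ≤ m) :
    (Measure.pi fun _ : Fin n => μ).real {y | (1 + 2 * η) * m ≤ ∑ k, D.indicator 1 (y k)} ≤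
      Real.exp (-(η ^ 2 * m)) := by
  refine (measureReal_mono fun y hy => ?_).trans
    ((pi_count_le_exp hD n η ((1 + 2 * η) * m)).trans ?_)
  · exact mul_le_mul_of_nonneg_left (a := η) hy hη
  · rw [Real.exp_le_exp]
    have h := exp_sub_one_le (abs_le.2 ⟨by linarith, hη1⟩)
    have h0 : 0 ≤ n * μ.real D := by positivity
    have h1 : 0 ≤ η + η ^ 2 := by positivity
    have h2 := mul_le_mul_of_nonneg_left h h0
    have h3 := mul_le_mul_of_nonneg_right hm h1
    nlinarith

/-- The summand `1` in the exponent pays for the count of `n` rather than `n + 1` points. -/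
lemma pi_count_lower_tail {D : Set E} (hD : MeasurableSet D) {n : ℕ} {η m : ℝ} (hη : 0 ≤ η)
    (hη1 : η ≤ 1) (hm : (n + 1) * μ.real D = m) :
    (Measure.pi fun _ : Fin n => μ).real {y | ∑ k, D.indicator 1 (y k) ≤ (1 - 2 * η) * m} ≤
      Real.exp (1 - η ^ 2 * m) := by
  refine (measureReal_mono fun y hy => ?_).trans
    ((pi_count_le_exp hD n (-η) ((1 - 2 * η) * m)).trans ?_)
  · exact mul_le_mul_of_nonpos_left (c := -η) hy (by linarith)
  · rw [Real.exp_le_exp]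
    have h := exp_sub_one_le (t := -η) (abs_le.2 ⟨by linarith, by linarith⟩)
    have h0 : 0 ≤ n * μ.real D := by positivity
    have h2 := mul_le_mul_of_nonneg_left h h0
    have hq : μ.real D ≤ 1 := measureReal_le_one
    have hq0 : 0 ≤ μ.real D := measureReal_nonneg
    have h3 : μ.real D * (η - η ^ 2) ≤ 1 := by nlinarith
    subst hm
    nlinarith

/-- Conditioning on one of `n + 1` independent points. -/
lemma pi_le_of_forall_slice {n : ℕ} (j : Fin (n + 1)) {B : Set (E × (Fin n → E))}
    (hB : MeasurableSet B) {b : ENNReal}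
    (h : ∀ p, (Measure.pi fun _ : Fin n => μ) {y | (p, y) ∈ B} ≤ b) :
    (Measure.pi fun _ : Fin (n + 1) => μ) {x | (x j, fun k => x (j.succAbove k)) ∈ B} ≤ b := by
  have h1 := (measurePreserving_piFinSuccAbove (fun _ : Fin (n + 1) => μ) j).measure_preimage
    hB.nullMeasurableSet
  have h2 : {x : Fin (n + 1) → E | (x j, fun k => x (j.succAbove k)) ∈ B} =
      MeasurableEquiv.piFinSuccAbove (fun _ => E) j ⁻¹' B := rfl
  rw [h2, h1, Measure.prod_apply hB]
  refine (lintegral_mono h).trans ?_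
  simp

lemma measurable_count_prod {n : ℕ} {R : E → Set E} (hR : MeasurableSet {z : E × E | z.2 ∈ R z.1}) :
    Measurable fun z : E × (Fin n → E) => ∑ k, (R z.1).indicator (1 : E → ℝ) (z.2 k) := by
  refine Finset.measurable_sum _ fun k _ => ?_
  exact (measurable_one.indicator hR).comp
    (measurable_fst.prodMk ((measurable_pi_apply k).comp measurable_snd))

end Chernoff

/-! ### Density of the nodes in the square -/

lemma exists_mem_Icc_subdivision (hL : 0 < L) {K : ℕ} (hK : 0 < K) {u : ℝ} (hu : u ∈ Set.Icc 0 L) :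
    ∃ a : Fin K, u ∈ Set.Icc (a * (L / K)) ((a + 1) * (L / K)) := by
  have hK' : (0 : ℝ) < K := Nat.cast_pos.2 hK
  have hLK : 0 < L / K := by positivity
  -- The right endpoint belongs to the last interval, where the floor would be off by one.
  rcases hu.2.eq_or_lt with rfl | h
  · refine ⟨⟨K - 1, by omega⟩, ?_⟩
    have h1 : ((K - 1 : ℕ) : ℝ) = K - 1 := by rw [Nat.cast_sub hK, Nat.cast_one]
    simp only [h1, sub_add_cancel]
    have h2 : (K : ℝ) * (u / K) = u := by field_simp
    constructor <;> nlinarith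
  · have h0 : 0 ≤ u / (L / K) := div_nonneg hu.1 hLK.le
    refine ⟨⟨⌊u / (L / K)⌋₊, ?_⟩, ?_, ?_⟩
    · rw [Nat.floor_lt h0, div_lt_iff₀ hLK, mul_div_cancel₀ _ hK'.ne']
      exact h
    · exact (le_div_iff₀ hLK).1 (Nat.floor_le h0)
    · exact ((div_lt_iff₀ hLK).1 (Nat.lt_floor_add_one _)).le

/-- The closed cells of the subdivision of the square of side `L` into `K ^ 2` squares. -/
def cell (L : ℝ) (K : ℕ) (c : Fin 2 → Fin K) : Set Plane :=
  {p | ∀ k, p k ∈ Set.Icc ((c k : ℝ) * (L / K)) (((c k : ℝ) + 1) * (L / K))}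

lemma measurableSet_cell (L : ℝ) (K : ℕ) (c : Fin 2 → Fin K) : MeasurableSet (cell L K c) :=
  measurableSet_box _ _

lemma exists_mem_cell (hL : 0 < L) {K : ℕ} (hK : 0 < K) {p : Plane} (hp : p ∈ square L) :
    ∃ c, p ∈ cell L K c := by
  choose c hc using fun k => exists_mem_Icc_subdivision hL hK (hp k)
  exact ⟨c, hc⟩

lemma dist_le_of_mem_cell {K : ℕ} {c : Fin 2 → Fin K} {p q : Plane} (hp : p ∈ cell L K c)
    (hq : q ∈ cell L K c) : dist p q ≤ 2 * (L / K) := by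
  have h : ∀ k, |p k - q k| ≤ L / K := fun k => by
    have h1 := hp k
    have h2 := hq k
    exact abs_le.2 ⟨by linarith [h1.1, h2.2], by linarith [h1.2, h2.1]⟩
  have h0 : 0 ≤ L / K := (abs_nonneg _).trans (h 0)
  rw [EuclideanSpace.dist_eq, Fin.sum_univ_two]
  refine Real.sqrt_le_iff.2 ⟨by positivity, ?_⟩
  simp only [Real.dist_eq]
  have h1 := pow_le_pow_left₀ (abs_nonneg _) (h 0) 2
  have h2 := pow_le_pow_left₀ (abs_nonneg _) (h 1) 2
  nlinarith

lemma cell_subset_square (hL : 0 < L) {K : ℕ} (c : Fin 2 → Fin K) : cell L K c ⊆ square L := by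
  intro p hp k
  have hK : 0 < K := (c 0).pos
  have hK' : (0 : ℝ) < K := Nat.cast_pos.2 hK
  have hLK : 0 < L / K := by positivity
  have h1 : ((c k : ℕ) : ℝ) + 1 ≤ K := by exact_mod_cast (c k).2
  refine ⟨le_trans (by positivity) (hp k).1, (hp k).2.trans ?_⟩
  calc ((c k : ℝ) + 1) * (L / K) ≤ K * (L / K) := by gcongr
    _ = L := by field_simp

lemma uniformSquare_real_cell (hL : 0 < L) {K : ℕ} (c : Fin 2 → Fin K) :
    (uniformSquare L).real (cell L K c) = 1 / (K : ℝ) ^ 2 := by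
  have hK' : (0 : ℝ) < K := Nat.cast_pos.2 (c 0).pos
  rw [uniformSquare_real_eq hL (c := (L / K) ^ 2) (by positivity) (cell_subset_square hL c)]
  · field_simp
  · rw [cell, volume_box (fun k => (c k : ℝ) * (L / K)), ENNReal.ofReal_pow (by positivity), sq]
    ring_nf

/-- The distribution of `N` independent uniformly distributed nodes in the square of side `L`. -/
noncomputable abbrev uniformNodes (L : ℝ) (N : ℕ) : Measure (Fin N → Plane) :=
  Measure.pi fun _ => uniformSquare L

lemma isProbabilityMeasure_uniformNodes (hL : 0 < L) (N : ℕ) :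
    IsProbabilityMeasure (uniformNodes L N) := by
  have := isProbabilityMeasure_uniformSquare hL
  infer_instance

lemma uniformNodes_not_mem_square_eq_zero (hL : 0 < L) (N : ℕ) :
    uniformNodes L N {x | ¬ ∀ j, x j ∈ square L} = 0 := by
  have := isProbabilityMeasure_uniformSquare hL
  have h : {x : Fin N → Plane | ¬ ∀ j, x j ∈ square L} =
      ⋃ j, Function.eval j ⁻¹' (square L)ᶜ := by
    ext x; simp
  rw [h]
  refine measure_iUnion_null fun j => ?_
  rw [(measurePreserving_eval (fun _ : Fin N => uniformSquare L) j).measure_preimage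
    (measurableSet_square L).compl.nullMeasurableSet]
  exact uniformSquare_compl_square L

/-- Unless the nodes are `δ`-dense, one of the cells is empty. -/
lemma uniformNodes_not_dense_le (hL : 0 < L) (N : ℕ) {K : ℕ} (hK : 0 < K) {δ : ℝ}
    (hδ : 2 * (L / K) ≤ δ) :
    (uniformNodes L N).real {x | ¬ ∀ p ∈ square L, ∃ j, dist (x j) p ≤ δ} ≤
      (K : ℝ) ^ 2 * Real.exp (-(N / (K : ℝ) ^ 2)) := by
  have := isProbabilityMeasure_uniformSquare hL
  have hcell : ∀ c : Fin 2 → Fin K,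
      (uniformNodes L N).real (Set.univ.pi fun _ => (cell L K c)ᶜ) ≤
        Real.exp (-(N / (K : ℝ) ^ 2)) := by
    intro c
    rw [measureReal_def, Measure.pi_pi, ENNReal.toReal_prod]
    simp_rw [← measureReal_def]
    rw [Finset.prod_const, Finset.card_univ, Fintype.card_fin,
      probReal_compl_eq_one_sub (measurableSet_cell L K c), uniformSquare_real_cell hL]
    have h1 : 0 ≤ 1 - 1 / (K : ℝ) ^ 2 := by
      rw [← uniformSquare_real_cell hL c]
      linarith [measureReal_le_one (μ := uniformSquare L) (s := cell L K c)]
    calc (1 - 1 / (K : ℝ) ^ 2) ^ N ≤ Real.exp (-(1 / (K : ℝ) ^ 2)) ^ N := by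
          refine pow_le_pow_left₀ h1 ?_ N
          linarith [Real.add_one_le_exp (-(1 / (K : ℝ) ^ 2))]
      _ = Real.exp (-(N / (K : ℝ) ^ 2)) := by
          rw [← Real.exp_nat_mul]
          ring_nf
  have hsub : {x : Fin N → Plane | ¬ ∀ p ∈ square L, ∃ j, dist (x j) p ≤ δ} ⊆
      ⋃ c : Fin 2 → Fin K, Set.univ.pi fun _ => (cell L K c)ᶜ := by
    intro x hx
    simp only [Set.mem_ofPred_eq, not_forall, not_exists] at hx
    obtain ⟨p, hp, hx⟩ := hx
    obtain ⟨c, hc⟩ := exists_mem_cell hL hK hp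
    refine Set.mem_iUnion.2 ⟨c, fun j _ hj => hx j ?_⟩
    exact (dist_le_of_mem_cell hj hc).trans hδ
  calc _ ≤ (uniformNodes L N).real (⋃ c : Fin 2 → Fin K, Set.univ.pi fun _ => (cell L K c)ᶜ) :=
        measureReal_mono hsub
    _ ≤ ∑ c : Fin 2 → Fin K, (uniformNodes L N).real (Set.univ.pi fun _ => (cell L K c)ᶜ) :=
        measureReal_iUnion_fintype_le _
    _ ≤ ∑ _c : Fin 2 → Fin K, Real.exp (-(N / (K : ℝ) ^ 2)) :=
        Finset.sum_le_sum fun c _ => hcell c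
    _ = _ := by simp

/-! ### Most configurations are typical -/

open Classical in
/-- A region `R p` of the expected size for every inner point `p` has, with high probability, nearly
the expected number of nodes for every inner node `p`. -/
lemma uniformNodes_count_lt_le (hL : 0 < L) (n : ℕ) {η m : ℝ} (hη : 0 ≤ η) (hη1 : η ≤ 1)
    {R : Plane → Set Plane} (hR : MeasurableSet {z : Plane × Plane | z.2 ∈ R z.1})
    (hm : ∀ p ∈ square L, p ∉ border L ρ → (n + 1) * (uniformSquare L).real (R p) = m)
    (j : Fin (n + 1)) :
    (uniformNodes L (n + 1)).real {x | x j ∈ square L ∧ x j ∉ border L ρ ∧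
      ((Finset.univ.filter fun k => k ≠ j ∧ x k ∈ R (x j)).card : ℝ) ≤ (1 - 2 * η) * m} ≤
        Real.exp (1 - η ^ 2 * m) := by
  have := isProbabilityMeasure_uniformSquare hL
  have hA : MeasurableSet {p : Plane | p ∈ square L ∧ p ∉ border L ρ} :=
    (measurableSet_square L).inter (measurableSet_border L ρ).compl
  have hB : MeasurableSet {z : Plane × (Fin n → Plane) | (z.1 ∈ square L ∧ z.1 ∉ border L ρ) ∧
      ∑ k, (R z.1).indicator (1 : Plane → ℝ) (z.2 k) ≤ (1 - 2 * η) * m} :=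
    (measurable_fst hA).inter (measurableSet_le (measurable_count_prod hR) measurable_const)
  have h := pi_le_of_forall_slice (μ := uniformSquare L) j hB
    (b := ENNReal.ofReal (Real.exp (1 - η ^ 2 * m))) (fun p => by
      by_cases hp : p ∈ square L ∧ p ∉ border L ρ
      · rw [ENNReal.le_ofReal_iff_toReal_le (measure_ne_top _ _) (Real.exp_pos _).le,
          ← measureReal_def]
        refine (measureReal_mono fun y hy => hy.2).trans (pi_count_lower_tail
          (measurable_prodMk_left (x := p) hR) hη hη1 (hm p hp.1 hp.2))
      · simp [hp])
  refine ENNReal.toReal_le_of_le_ofReal (Real.exp_pos _).le (le_trans (measure_mono ?_) h)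
  rintro x ⟨h1, h2, h3⟩
  rw [card_filter_ne_eq_sum R j x] at h3
  exact ⟨⟨h1, h2⟩, h3⟩

open Classical in
lemma uniformNodes_lt_count_le (hL : 0 < L) (n : ℕ) {η m : ℝ} (hη : 0 ≤ η) (hη1 : η ≤ 1)
    {R : Plane → Set Plane} (hR : MeasurableSet {z : Plane × Plane | z.2 ∈ R z.1})
    (hm : ∀ p, n * (uniformSquare L).real (R p) ≤ m) (j : Fin (n + 1)) :
    (uniformNodes L (n + 1)).real {x |
      (1 + 2 * η) * m ≤ (Finset.univ.filter fun k => k ≠ j ∧ x k ∈ R (x j)).card} ≤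
        Real.exp (-(η ^ 2 * m)) := by
  have := isProbabilityMeasure_uniformSquare hL
  have hB : MeasurableSet {z : Plane × (Fin n → Plane) |
      (1 + 2 * η) * m ≤ ∑ k, (R z.1).indicator (1 : Plane → ℝ) (z.2 k)} :=
    measurableSet_le measurable_const (measurable_count_prod hR)
  have h := pi_le_of_forall_slice (μ := uniformSquare L) j hB
    (b := ENNReal.ofReal (Real.exp (-(η ^ 2 * m)))) (fun p => by
      rw [ENNReal.le_ofReal_iff_toReal_le (measure_ne_top _ _) (Real.exp_pos _).le,
          ← measureReal_def]
      exact pi_count_upper_tail (measurable_prodMk_left (x := p) hR) hη hη1 (hm p))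
  refine ENNReal.toReal_le_of_le_ofReal (Real.exp_pos _).le (le_trans (measure_mono ?_) h)
  intro x h3
  rw [Set.mem_ofPred_eq, card_filter_ne_eq_sum R j x] at h3
  exact h3

/-- The union bound over the events that make up `IsTypical`. -/
theorem uniformNodes_not_isTypical_le (hρ : 0 ≤ ρ) (hL : 0 < L) {N : ℕ} (hN : 0 < N) {K : ℕ}
    (hK : 0 < K) {η δ : ℝ} (hη : 0 ≤ η) (hη1 : η ≤ 1) (hδ : 2 * (L / K) ≤ δ) :
    (uniformNodes L N).real {x | ¬ IsTypical ρ L (expectedNeighbors ρ L N) (2 * η) δ x} ≤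
      3 * N * Real.exp (1 - η ^ 2 * (expectedNeighbors ρ L N / 2)) +
        (K : ℝ) ^ 2 * Real.exp (-(N / (K : ℝ) ^ 2)) := by
  classical
  obtain ⟨n, rfl⟩ : ∃ n, N = n + 1 := ⟨N - 1, by omega⟩
  have := isProbabilityMeasure_uniformSquare hL
  set M := expectedNeighbors ρ L (n + 1 : ℕ) with hMdef
  have hM : M = (n + 1) * (Real.pi * ρ ^ 2 / L ^ 2) := by
    rw [hMdef, expectedNeighbors]; push_cast; ring
  have hM0 : 0 ≤ M := by rw [hM]; positivity
  set Q := uniformNodes L (n + 1)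
  set b := Real.exp (1 - η ^ 2 * (M / 2))
  have hright := uniformNodes_count_lt_le (ρ := ρ) hL n hη hη1 (measurableSet_rightHalfDisk_prod ρ)
    (m := M / 2) (fun p hp hpB => by
      rw [uniformSquare_real_eq hL (by positivity)
        (fun q hq => disk_subset_square hp hpB hq.1) (volume_rightHalfDisk hρ p), hM]
      ring)
  have hleft := uniformNodes_count_lt_le (ρ := ρ) hL n hη hη1 (measurableSet_leftHalfDisk_prod ρ)
    (m := M / 2) (fun p hp hpB => by
      rw [uniformSquare_real_eq hL (by positivity) (fun q hq => disk_subset_square hp hpB hq.1)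
        ((volume_leftHalfDisk_eq ρ p).trans (volume_rightHalfDisk hρ p)), hM]
      ring)
  have hdisk := uniformNodes_lt_count_le hL n hη hη1 (R := fun p => {q | dist p q ≤ ρ})
    (measurableSet_disk_prod ρ) (m := M) (fun p => by
      have h := uniformSquare_real_le hL (c := Real.pi * ρ ^ 2) (by positivity)
        (volume_disk hρ p).le
      have h2 : (0 : ℝ) ≤ Real.pi * ρ ^ 2 / L ^ 2 := by positivity
      rw [hM]
      nlinarith [mul_le_mul_of_nonneg_left h (Nat.cast_nonneg (α := ℝ) n)])
  have hexp : Real.exp (-(η ^ 2 * M)) ≤ b := by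
    rw [Real.exp_le_exp]
    nlinarith [mul_nonneg (sq_nonneg η) hM0]
  set A₁ : Fin (n + 1) → Set (Fin (n + 1) → Plane) := fun j => {x | x j ∈ square L ∧
    x j ∉ border L ρ ∧ ((Finset.univ.filter fun k => k ≠ j ∧ x k ∈ rightHalfDisk ρ (x j)).card : ℝ)
      ≤ (1 - 2 * η) * (M / 2)}
  set A₂ : Fin (n + 1) → Set (Fin (n + 1) → Plane) := fun j => {x | x j ∈ square L ∧
    x j ∉ border L ρ ∧ ((Finset.univ.filter fun k => k ≠ j ∧ x k ∈ leftHalfDisk ρ (x j)).card : ℝ)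
      ≤ (1 - 2 * η) * (M / 2)}
  set A₃ : Fin (n + 1) → Set (Fin (n + 1) → Plane) := fun j => {x | (1 + 2 * η) * M ≤
    (Finset.univ.filter fun k => k ≠ j ∧ x k ∈ {q | dist (x j) q ≤ ρ}).card}
  set A₄ : Set (Fin (n + 1) → Plane) := {x | ¬ ∀ p ∈ square L, ∃ j, dist (x j) p ≤ δ}
  set A₀ : Set (Fin (n + 1) → Plane) := {x | ¬ ∀ j, x j ∈ square L}
  have hsub : {x | ¬ IsTypical ρ L M (2 * η) δ x} ⊆
      (A₀ ∪ ⋃ j, (A₁ j ∪ A₂ j ∪ A₃ j)) ∪ A₄ := by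
    intro x hx
    by_contra hxA
    simp only [Set.mem_union, Set.mem_iUnion, not_or, not_exists] at hxA
    obtain ⟨⟨h0, h123⟩, h4⟩ := hxA
    have h0' : ∀ j, x j ∈ square L := not_not.1 h0
    refine hx ⟨h0', fun j hj => ?_, fun j hj => ?_, fun j => ?_, not_not.1 h4⟩
    · by_contra! hlt
      refine (h123 j).1.1 ⟨h0' j, hj, le_trans ?_ hlt.le⟩
      exact Nat.cast_le.2 (Finset.card_le_card
        (Finset.monotone_filter_right _ fun k _ hk => hk.2))
    · by_contra! hlt
      refine (h123 j).1.2 ⟨h0' j, hj, le_trans ?_ hlt.le⟩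
      exact Nat.cast_le.2 (Finset.card_le_card
        (Finset.monotone_filter_right _ fun k _ hk => hk.2))
    · by_contra! hlt
      exact (h123 j).2 hlt.le
  have hA₀ : Q.real A₀ = 0 := by
    rw [measureReal_def, uniformNodes_not_mem_square_eq_zero hL, ENNReal.toReal_zero]
  have hA : Q.real (⋃ j, (A₁ j ∪ A₂ j ∪ A₃ j)) ≤ ∑ _j : Fin (n + 1), 3 * b := by
    refine (measureReal_iUnion_fintype_le _).trans (Finset.sum_le_sum fun j _ => ?_)
    have h1 : Q.real (A₁ j) ≤ b := hright j
    have h2 : Q.real (A₂ j) ≤ b := hleft j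
    have h3 : Q.real (A₃ j) ≤ b := (hdisk j).trans hexp
    linarith [measureReal_union_le (μ := Q) (A₁ j ∪ A₂ j) (A₃ j),
      measureReal_union_le (μ := Q) (A₁ j) (A₂ j)]
  have hA₄ : Q.real A₄ ≤ _ := uniformNodes_not_dense_le hL (n + 1) hK hδ
  rw [Finset.sum_const, Finset.card_univ, Fintype.card_fin, nsmul_eq_mul] at hA
  have hmono : Q.real _ ≤ _ := measureReal_mono hsub
  have hu1 := measureReal_union_le (μ := Q) (A₀ ∪ ⋃ j, (A₁ j ∪ A₂ j ∪ A₃ j)) A₄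
  have hu2 := measureReal_union_le (μ := Q) A₀ (⋃ j, (A₁ j ∪ A₂ j ∪ A₃ j))
  linarith

/-! ### The probability of atypical configurations tends to zero -/

/-- With the subdivision into cells of side about `δ / 2`, both terms of the union bound are
polynomials in `L` times `exp (-c * L ^ θ)`. -/
lemma tendsto_union_bound {ρ θ η δ : ℝ} (hρ : 0 < ρ) (hθ : 0 < θ) (hη : 0 < η) (hδ : 0 < δ)
    {L : ℕ → ℝ} {N : ℕ → ℕ} (hLpos : ∀ i, 0 < L i) (hL : Tendsto L atTop atTop)
    (hM : ∀ i, expectedNeighbors ρ (L i) (N i) = L i ^ θ) :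
    Tendsto (fun i => 3 * N i * Real.exp (1 - η ^ 2 * (expectedNeighbors ρ (L i) (N i) / 2)) +
      (⌈2 * L i / δ⌉₊ : ℝ) ^ 2 * Real.exp (-(N i / (⌈2 * L i / δ⌉₊ : ℝ) ^ 2))) atTop (nhds 0) := by
  have hπ : 0 < Real.pi * ρ ^ 2 := by positivity
  have hy : Tendsto (fun i => L i ^ θ) atTop atTop := (tendsto_rpow_atTop hθ).comp hL
  have hLy : ∀ i, L i ^ 2 = (L i ^ θ) ^ (2 / θ) := fun i => by
    rw [← Real.rpow_mul (hLpos i).le, mul_div_cancel₀ _ hθ.ne', Real.rpow_two]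
  have hN : ∀ i, (N i : ℝ) = L i ^ 2 * L i ^ θ / (Real.pi * ρ ^ 2) := fun i => by
    have := (hLpos i).ne'
    rw [← hM i, expectedNeighbors]
    field_simp
  have h1 : Tendsto (fun i => 3 * Real.exp 1 / (Real.pi * ρ ^ 2) *
      ((L i ^ θ) ^ (2 / θ + 1) * Real.exp (-(η ^ 2 / 2) * L i ^ θ))) atTop (nhds 0) := by
    simpa using ((tendsto_rpow_mul_exp_neg_mul_atTop_nhds_zero (2 / θ + 1) (η ^ 2 / 2)
      (by positivity)).comp hy).const_mul (3 * Real.exp 1 / (Real.pi * ρ ^ 2))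
  set b := δ ^ 2 / (9 * (Real.pi * ρ ^ 2)) with hb
  have h2 : Tendsto (fun i => 9 / δ ^ 2 *
      ((L i ^ θ) ^ (2 / θ) * Real.exp (-b * L i ^ θ))) atTop (nhds 0) := by
    simpa using ((tendsto_rpow_mul_exp_neg_mul_atTop_nhds_zero (2 / θ) b
      (by positivity)).comp hy).const_mul (9 / δ ^ 2)
  have h12 := h1.add h2
  rw [add_zero] at h12
  refine squeeze_zero' (Eventually.of_forall fun i => by positivity) ?_ h12
  filter_upwards [hL.eventually_ge_atTop δ] with i hi
  have hLi := hLpos i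
  have hyi : 0 < L i ^ θ := Real.rpow_pos_of_pos hLi θ
  refine add_le_add (le_of_eq ?_) ?_
  · rw [hM, hN, Real.rpow_add_one hyi.ne', ← hLy, Real.exp_sub, neg_mul, Real.exp_neg]
    field_simp
  · have hK0 : 0 < (⌈2 * L i / δ⌉₊ : ℝ) :=
      Nat.cast_pos.2 (Nat.ceil_pos.2 (by positivity))
    have hK : (⌈2 * L i / δ⌉₊ : ℝ) ≤ 3 * L i / δ := by
      have h3 := (Nat.ceil_lt_add_one (by positivity : 0 ≤ 2 * L i / δ)).le
      have h4 : 1 ≤ L i / δ := (one_le_div hδ).2 hi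
      calc (⌈2 * L i / δ⌉₊ : ℝ) ≤ 2 * L i / δ + L i / δ := by linarith
        _ = 3 * L i / δ := by ring
    have hK2 : (⌈2 * L i / δ⌉₊ : ℝ) ^ 2 ≤ 9 / δ ^ 2 * L i ^ 2 := by
      calc (⌈2 * L i / δ⌉₊ : ℝ) ^ 2 ≤ (3 * L i / δ) ^ 2 := pow_le_pow_left₀ hK0.le hK 2
        _ = 9 / δ ^ 2 * L i ^ 2 := by ring
    have hexp : b * L i ^ θ ≤ N i / (⌈2 * L i / δ⌉₊ : ℝ) ^ 2 := by
      rw [le_div_iff₀ (by positivity)]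
      calc b * L i ^ θ * (⌈2 * L i / δ⌉₊ : ℝ) ^ 2
          ≤ b * L i ^ θ * (9 / δ ^ 2 * L i ^ 2) := by gcongr
        _ = (N i : ℝ) := by rw [hN, hb]; field_simp
    rw [← hLy, ← mul_assoc, neg_mul]
    gcongr

section Network

variable {Ω : Type*} [MeasurableSpace Ω] {P : Measure Ω} [IsProbabilityMeasure P]

lemma map_eq_uniformNodes {L : ℝ} (hL : 0 < L) {N : ℕ} {X : Fin N → Ω → Plane}
    (hunif : ∀ j, pdf.IsUniform (X j) (square L) P volume) (hindep : iIndepFun X P) :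
    AEMeasurable (fun ω j => X j ω) P ∧ P.map (fun ω j => X j ω) = uniformNodes L N := by
  have hX : ∀ j, AEMeasurable (X j) P := fun j => (hunif j).aemeasurable
    (by rw [volume_square]; simpa using hL) (by rw [volume_square]; finiteness)
  refine ⟨aemeasurable_pi_lambda _ hX, ?_⟩
  rw [(iIndepFun_iff_map_fun_eq_pi_map hX).1 hindep]
  exact congrArg Measure.pi (funext fun j => hunif j)

lemma tendsto_measure_not_isTypical {ρ θ η δ : ℝ} (hρ : 0 < ρ) (hθ : 0 < θ) (hη : 0 < η)
    (hη1 : η ≤ 1) (hδ : 0 < δ) {L : ℕ → ℝ} {N : ℕ → ℕ} {X : (i : ℕ) → Fin (N i) → Ω → Plane}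
    (hLpos : ∀ i, 0 < L i) (hL : Tendsto L atTop atTop)
    (hM : ∀ i, expectedNeighbors ρ (L i) (N i) = L i ^ θ)
    (hunif : ∀ i j, pdf.IsUniform (X i j) (square (L i)) P volume)
    (hindep : ∀ i, iIndepFun (X i) P) :
    Tendsto (fun i => P {ω | ¬ IsTypical ρ (L i) (expectedNeighbors ρ (L i) (N i)) (2 * η) δ
      fun j => X i j ω}) atTop (nhds 0) := by
  have hbound := ENNReal.tendsto_ofReal (tendsto_union_bound hρ hθ hη hδ hLpos hL hM)
  rw [ENNReal.ofReal_zero] at hbound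
  refine tendsto_of_tendsto_of_tendsto_of_le_of_le tendsto_const_nhds hbound
    (fun i => zero_le) fun i => ?_
  have hLi := hLpos i
  have := isProbabilityMeasure_uniformNodes hLi (N i)
  obtain ⟨hX, hmap⟩ := map_eq_uniformNodes hLi (hunif i) (hindep i)
  have hN : 0 < N i := by
    refine Nat.pos_of_ne_zero fun h => (Real.rpow_pos_of_pos hLi θ).ne' ?_
    rw [← hM i, expectedNeighbors, h]
    simp
  have hK : 0 < ⌈2 * L i / δ⌉₊ := Nat.ceil_pos.2 (by positivity)
  have hcell : 2 * (L i / (⌈2 * L i / δ⌉₊ : ℝ)) ≤ δ := by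
    rw [← mul_div_assoc, div_le_iff₀ (Nat.cast_pos.2 hK), ← div_le_iff₀' hδ]
    exact Nat.le_ceil _
  refine (Measure.le_map_apply hX {x | ¬ IsTypical ρ (L i)
    (expectedNeighbors ρ (L i) (N i)) (2 * η) δ x}).trans ?_
  rw [hmap, ENNReal.le_ofReal_iff_toReal_le (measure_ne_top _ _) (by positivity)]
  exact uniformNodes_not_isTypical_le hρ.le hLi hN hK hη.le hη1 hcell

/-- A quantity that is close to `1` on typical configurations tends to `1` in probability. -/
lemma tendstoInMeasure_one_of_isTypical {ρ θ δ : ℝ} (hρ : 0 < ρ) (hθ : 0 < θ) (hδ : 0 < δ)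
    {L : ℕ → ℝ} {N : ℕ → ℕ} {X : (i : ℕ) → Fin (N i) → Ω → Plane}
    (hLpos : ∀ i, 0 < L i) (hL : Tendsto L atTop atTop)
    (hM : ∀ i, expectedNeighbors ρ (L i) (N i) = L i ^ θ)
    (hunif : ∀ i j, pdf.IsUniform (X i j) (square (L i)) P volume)
    (hindep : ∀ i, iIndepFun (X i) P) {f : ℕ → Ω → ℝ}
    (hf : ∀ ε, 0 < ε → ∀ᶠ i in atTop, ∀ ω,
      IsTypical ρ (L i) (expectedNeighbors ρ (L i) (N i)) ε δ (fun j => X i j ω) →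
        |f i ω - 1| ≤ ε) :
    TendstoInMeasure P f atTop fun _ => (1 : ℝ) := by
  rw [tendstoInMeasure_iff_dist]
  intro ε hε
  have hη : 0 < min (ε / 4) 1 := lt_min (by positivity) one_pos
  have hηε : 2 * min (ε / 4) 1 < ε := by linarith [min_le_left (ε / 4) 1]
  refine tendsto_of_tendsto_of_tendsto_of_le_of_le' tendsto_const_nhds
    (tendsto_measure_not_isTypical hρ hθ hη (min_le_right _ _) hδ hLpos hL hM hunif hindep)
    (Eventually.of_forall fun i => zero_le) ?_
  filter_upwards [hf (2 * min (ε / 4) 1) (by positivity)] with i hi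
  refine measure_mono fun ω hω htyp => ?_
  exact (hηε.trans_le hω).not_ge (hi ω htyp)

end Network

lemma abs_div_sub_one_le {a M ε : ℝ} (hM : 0 < M) (h1 : (1 - ε) * M ≤ a) (h2 : a ≤ (1 + ε) * M) :
    |a / M - 1| ≤ ε := by
  rw [abs_le]
  have h3 := (le_div_iff₀ hM).2 h1
  have h4 := (div_le_iff₀ hM).2 h2
  constructor <;> linarith

end BroadcastNetwork

open BroadcastNetwork in
theorem mainTheorem2 {Ω : Type*} [MeasurableSpace Ω] (P : Measure Ω) [IsProbabilityMeasure P]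
    (ρ W θ : ℝ) (hρ : 0 < ρ) (hW : ρ < W) (hθ : 0 < θ)
    -- side length, number of nodes, node positions and source of the `i`-th network
    (L : ℕ → ℝ) (N : ℕ → ℕ)
    (X : (i : ℕ) → Fin (N i) → Ω → BroadcastNetwork.Plane)
    (s : (i : ℕ) → Ω → Fin (N i))
    (hLpos : ∀ i, 0 < L i) (hL : Tendsto L atTop atTop)
    (hM : ∀ i, BroadcastNetwork.expectedNeighbors ρ (L i) (N i) = L i ^ θ)
    (hunif : ∀ i j, pdf.IsUniform (X i j) (BroadcastNetwork.square (L i)) P volume)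
    (hindep : ∀ i, iIndepFun (X i) P) :
    TendstoInMeasure P
      (fun i ω => BroadcastNetwork.irenIronMinCut ρ W (L i) (fun j => X i j ω) (s i ω) /
        BroadcastNetwork.expectedNeighbors ρ (L i) (N i))
      atTop (fun _ => (1 : ℝ)) ∧
    TendstoInMeasure P
      (fun i ω => (BroadcastNetwork.maxNeighbors ρ (fun j => X i j ω) : ℝ) /
        BroadcastNetwork.expectedNeighbors ρ (L i) (N i))
      atTop (fun _ => (1 : ℝ)) := by
  -- `2 * δ ≤ ρ` makes two nodes close to a common point neighbors, and `ρ + δ ≤ W` keeps nodes close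
  -- to the border of width `ρ` in the border of width `W`.
  obtain ⟨δ, hδ, hδρ, hδW⟩ : ∃ δ : ℝ, 0 < δ ∧ 2 * δ ≤ ρ ∧ ρ + δ ≤ W :=
    ⟨min (ρ / 2) (W - ρ), lt_min (by positivity) (by linarith),
      by linarith [min_le_left (ρ / 2) (W - ρ)], by linarith [min_le_right (ρ / 2) (W - ρ)]⟩
  have hM1 : ∀ᶠ i in atTop, 1 ≤ expectedNeighbors ρ (L i) (N i) := by
    simp_rw [hM]
    exact ((tendsto_rpow_atTop hθ).comp hL).eventually_ge_atTop 1
  have hN2 : ∀ᶠ i in atTop, 2 ≤ N i := by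
    filter_upwards [hM1, ((tendsto_pow_atTop two_ne_zero).comp hL).eventually_gt_atTop
      (Real.pi * ρ ^ 2)] with i h1 h2
    have h3 : 0 < L i ^ 2 := by have := hLpos i; positivity
    rw [expectedNeighbors, ← mul_div_assoc, one_le_div h3] at h1
    have h4 : Real.pi * ρ ^ 2 * 1 < Real.pi * ρ ^ 2 * N i := by
      rw [mul_one]
      exact lt_of_lt_of_le h2 h1
    exact_mod_cast lt_of_mul_lt_mul_left h4 (by positivity)
  refine ⟨tendstoInMeasure_one_of_isTypical hρ hθ hδ hLpos hL hM hunif hindep fun ε hε => ?_,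
    tendstoInMeasure_one_of_isTypical hρ hθ hδ hLpos hL hM hunif hindep fun ε hε => ?_⟩
  · filter_upwards [hM1, hN2] with i hMi hNi ω hω
    refine abs_div_sub_one_le (by linarith)
      (hω.le_irenIronMinCut hρ (hLpos i).le hδ.le hδρ hδW hε.le hNi hMi (s i ω))
      ((irenIronMinCut_le hNi hMi (s i ω)).trans ?_)
    nlinarith
  · filter_upwards [hM1, hL.eventually_gt_atTop (2 * (ρ + δ))] with i hMi hLi ω hω
    exact abs_div_sub_one_le (by linarith) (hω.le_maxNeighbors (hLpos i).le hLi)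
      (hω.maxNeighbors_le (by positivity))
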